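/- Let $n\ge 1$ be an integer and let $\mathbb{U}=\{z\in\mathbb{C}:|z|<1\}$. Let $\mathcal{A}_n$ be the class of functions analytic in $\mathbb{U}$ of the form $f(z)=z+a_{n+1}z^{n+1}+a_{n+2}z^{n+2}+\cdots$. For $0<\mu\le 1$ let $\mathcal{STS}(\mu)$ be the class of those $f\in\mathcal{A}_n$ for which $f(z)\ne 0$ for $0<|z|<1$ and $$\left|\arg\left(\frac{zf'(z)}{f(z)}\right)\right|<\frac{\pi}{2}\mu\qquad(z\in\mathbb{U}),$$ where the quotient has the value $1$ at $z=0$, and put $$\phi(\mu)=\frac{\pi}{2}(\mu+1)-\arctan\frac{\cos\frac{\mu\pi}{2}}{\sin\frac{\mu\pi}{2}+\frac{n\mu}{1-\mu}\left(\frac{1-\mu}{1+\mu}\right)^{\frac{1+\mu}{2}}}\quad(0<\mu<1),\qquad \phi(1)=\lim_{\mu\to1^-}\phi(\mu)=\pi.$$ Here $\arg$ is the principal argument, and a bound on $|\arg w|$ includes the assertion $w\ne 0$. Let $0<\mu\le 1$, let $\alpha,\gamma>0$ and $\beta$ be real numbers with $$\alpha=\beta+\frac{2}{\pi}\arctan(n\beta),\qquad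 \beta=\gamma+\frac{2}{\pi}\arctan(n\gamma),\qquad \frac{\pi}{2}(\alpha+\gamma)\le\phi(\mu),$$ and let $f\in\mathcal{A}_n$ satisfy $$|\arg(f'(z)+zf''(z))|<\frac{\pi}{2}\alpha\qquad(z\in\mathbb{U}).$$ Then $f\in\mathcal{STS}(\mu)$. -/

import Mathlib

/-- The open unit disk. -/
def unitDisk : Set ℂ := Metric.ball 0 1

/-- The class `𝒜ₙ`: functions analytic in the open unit disk with the expansion
`f(z) = z + a_{n+1} z^{n+1} + a_{n+2} z^{n+2} + ⋯` there. -/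
def classA (n : ℕ) : Set (ℂ → ℂ) :=
  {f | AnalyticOnNhd ℂ f unitDisk ∧
    ∃ a : ℕ → ℂ, ∀ z ∈ unitDisk,
      HasSum (fun k : ℕ => a (n + 1 + k) * z ^ (n + 1 + k)) (f z - z)}

/-- `|arg w| < c`, for the principal argument. The argument of `0` is undefined, so the
inequality includes `w ≠ 0`. -/
def AbsArgLt (w : ℂ) (c : ℝ) : Prop := w ≠ 0 ∧ |Complex.arg w| < c

/-- The class `𝒮𝒯𝒮(μ)` of strongly starlike functions of order `μ` in `𝒜ₙ`, for `0 < μ ≤ 1`.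
At `z = 0` the quotient `z f'(z) / f(z)` has a removable singularity with value `1`, whose
argument is `0`, so the condition is only stated for `z ≠ 0`; there it includes that
`f z ≠ 0`, so that the quotient is defined. -/
def classSTS (n : ℕ) (μ : ℝ) : Set (ℂ → ℂ) :=
  {f | f ∈ classA n ∧ 0 < μ ∧ μ ≤ 1 ∧
    ∀ z ∈ unitDisk, z ≠ 0 →
      f z ≠ 0 ∧ AbsArgLt (z * deriv f z / f z) (Real.pi / 2 * μ)}

/-- The bound `ϕ(μ)`. For `μ = 1` the term with `1 - μ` in the denominator is to be read as a
limit, which gives `ϕ(1) = π`; the formula below has that value too (see `phi_one`). -/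
noncomputable def phi (n : ℕ) (μ : ℝ) : ℝ :=
  Real.pi / 2 * (μ + 1) -
    Real.arctan (Real.cos (μ * Real.pi / 2) /
      (Real.sin (μ * Real.pi / 2) +
        n * μ / (1 - μ) * ((1 - μ) / (1 + μ)) ^ ((1 + μ) / 2)))

theorem phi_one (n : ℕ) : phi n 1 = Real.pi := by
  simp [phi]
  ring

/-! Write `f(z) = z q(z)` with `q = dslope f 0`, so that `f' = q + z q'`. Bounding `arg p` in terms
of `arg (p + z p')`, first for `p = f'` and then for `p = q`, gives `|arg f'| < πβ/2` and
`|arg q| < πγ/2`.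

The bound is a first-exit argument. If `p = 1 + O(zⁿ)` leaves the sector `|arg w| < πβ/2` for the
first time at `z₀` and `p(z₀) ≠ 0`, then Jack's lemma (`exists_mul_deriv_eq_mul_of_norm_le`) for
the Cayley transform of `p ^ (1 / β)` yields Nunokawa's lemma
(`exists_mul_deriv_eq_mul_of_abs_arg_eq`): `z₀ p'(z₀) = i ℓ p(z₀)` with `ℓ` of the sign of
`Im p(z₀)` and `|ℓ| ≥ nβ (a + a⁻¹) / 2`, `a = |p(z₀)| ^ (1 / β)`. Hence `arg (p + z p')` is at least
`πβ/2 + arctan (nβ)` in absolute value at `z₀`.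

The quotient `P = f' / q = z f' / f` satisfies `P² + z P' = (f' + z f'') / q`, whose argument is
below `π(α + γ)/2 ≤ ϕ(μ)` in absolute value. At a first exit of `P` from `|arg w| < πμ/2` this
expression equals `P (P + iℓ)`, and minimising `(a + a⁻¹) / (2 a ^ μ)` over `a > 0` by weighted
AM-GM shows that its argument is at least `ϕ(μ)` in absolute value, a contradiction.
-/

open Asymptotics Complex Filter Metric Set Topology
open scoped ComplexConjugate ComplexOrder Real

theorem exists_mem_frontier_of_not_mapsTo {E Y : Type*} [NormedAddCommGroup E] [NormedSpace ℝ E]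
    [ProperSpace E] [TopologicalSpace Y] {p : E → Y} {V : Set Y} {R : ℝ} (hV : IsOpen V)
    (hp : ContinuousOn p (ball 0 R)) (h0 : p 0 ∈ V) (hex : ¬ MapsTo p (ball 0 R) V) :
    ∃ z₀ ∈ ball 0 R, z₀ ≠ 0 ∧ MapsTo p (ball 0 ‖z₀‖) V ∧ p z₀ ∈ frontier V := by
  obtain ⟨z₁, hz₁, hpz₁⟩ : ∃ z₁ ∈ ball 0 R, p z₁ ∉ V := by simpa [MapsTo] using hex
  have hsub : closedBall 0 ‖z₁‖ ⊆ ball (0 : E) R :=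
    closedBall_subset_ball (mem_ball_zero_iff.1 hz₁)
  have hcompact : IsCompact (closedBall 0 ‖z₁‖ ∩ p ⁻¹' Vᶜ) :=
    (isCompact_closedBall 0 ‖z₁‖).of_isClosed_subset
      ((hp.mono hsub).preimage_isClosed_of_isClosed isClosed_closedBall hV.isClosed_compl)
      inter_subset_left
  obtain ⟨z₀, ⟨hz₀, hpz₀⟩, hmin⟩ :=
    hcompact.exists_isMinOn ⟨z₁, by simp, hpz₁⟩ continuous_norm.continuousOn
  have hne : z₀ ≠ 0 := fun h => hpz₀ (h ▸ h0)
  have hmaps : MapsTo p (ball 0 ‖z₀‖) V := by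
    intro z hz
    rw [mem_ball_zero_iff] at hz
    by_contra hpz
    have hz' : z ∈ closedBall 0 ‖z₁‖ := by
      simpa using hz.le.trans (mem_closedBall_zero_iff.1 hz₀)
    exact (hmin ⟨hz', hpz⟩).not_gt hz
  have hclosure : z₀ ∈ closure (ball 0 ‖z₀‖) := by
    rw [closure_ball 0 (norm_ne_zero_iff.2 hne)]
    simp
  have hcont : ContinuousAt p z₀ := hp.continuousAt (isOpen_ball.mem_nhds (hsub hz₀))
  refine ⟨z₀, hsub hz₀, hne, hmaps, ?_⟩
  rw [hV.frontier_eq]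
  exact ⟨hcont.continuousWithinAt.mem_closure hclosure hmaps, hpz₀⟩

/-! ### Sectors -/

theorem continuousAt_abs_arg {w : ℂ} (hw : w ≠ 0) : ContinuousAt (fun z => |arg z|) w := by
  have hangle : ContinuousAt (fun z : ℂ => InnerProductGeometry.angle z 1) w :=
    (InnerProductGeometry.continuousAt_angle (x := (w, (1 : ℂ))) hw one_ne_zero).comp
      (f := fun z : ℂ => (z, (1 : ℂ))) (by fun_prop)
  refine hangle.congr ?_
  filter_upwards [isOpen_ne.mem_nhds hw] with z hz using angle_one_right hz

theorem abs_arg_mul {x y : ℂ} (hx : x ≠ 0) (hy : y ≠ 0) (him : 0 ≤ x.im * y.im)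
    (hle : |arg x| + |arg y| ≤ π) : |arg (x * y)| = |arg x| + |arg y| := by
  wlog h : 0 ≤ x.im ∧ 0 ≤ y.im generalizing x y
  · have h' : x.im ≤ 0 ∧ y.im ≤ 0 := (mul_nonneg_iff.1 him).resolve_left h
    have hx' : 0 ≤ x⁻¹.im := by
      rw [inv_im]
      exact div_nonneg (neg_nonneg.2 h'.1) (normSq_nonneg x)
    have hy' : 0 ≤ y⁻¹.im := by
      rw [inv_im]
      exact div_nonneg (neg_nonneg.2 h'.2) (normSq_nonneg y)
    simpa only [← mul_inv, abs_arg_inv] using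
      this (inv_ne_zero hx) (inv_ne_zero hy) (mul_nonneg hx' hy') (by simpa using hle) ⟨hx', hy'⟩
  · have hx' : 0 ≤ arg x := arg_nonneg_iff.2 h.1
    have hy' : 0 ≤ arg y := arg_nonneg_iff.2 h.2
    rw [abs_of_nonneg hx', abs_of_nonneg hy'] at hle ⊢
    rw [arg_mul hx hy ⟨by linarith [Real.pi_pos], hle⟩, abs_of_nonneg (add_nonneg hx' hy')]

theorem abs_arg_eq_pi_div_two_sub_arctan {z : ℂ} (hz : z.im ≠ 0) :
    |arg z| = π / 2 - Real.arctan (z.re / |z.im|) := by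
  have harccos : |arg z| = Real.arccos (z.re / ‖z‖) := by
    rcases hz.lt_or_gt with h | h
    · rw [arg_of_im_neg h, abs_neg, abs_of_nonneg (Real.arccos_nonneg _)]
    · rw [arg_of_im_pos h, abs_of_nonneg (Real.arccos_nonneg _)]
  have hsqrt : |z.im| * √(1 + (z.re / |z.im|) ^ 2) = ‖z‖ := by
    rw [← Real.sqrt_sq (abs_nonneg z.im), ← Real.sqrt_mul (sq_nonneg _),
      norm_eq_sqrt_sq_add_sq, Real.sqrt_sq (abs_nonneg z.im)]
    congr 1
    have := abs_ne_zero.2 hz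
    field_simp
    rw [sq_abs, add_comm]
  rw [harccos, Real.arctan_eq_arcsin, div_div, hsqrt]
  rfl

theorem abs_arg_one_add_mul_I (t : ℝ) : |arg (1 + t * I)| = Real.arctan |t| := by
  rcases eq_or_ne t 0 with rfl | ht
  · simp
  · rw [abs_arg_eq_pi_div_two_sub_arctan (by simpa using ht)]
    have := Real.arctan_inv_of_pos (abs_pos.2 ht)
    simp [this]

theorem AbsArgLt.mono {w : ℂ} {c d : ℝ} (hw : AbsArgLt w c) (hcd : c ≤ d) : AbsArgLt w d :=
  ⟨hw.1, hw.2.trans_le hcd⟩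

theorem AbsArgLt.div {u v : ℂ} {c d : ℝ} (hu : AbsArgLt u c) (hv : AbsArgLt v d) :
    AbsArgLt (u / v) (c + d) := by
  refine ⟨div_ne_zero hu.1 hv.1, ?_⟩
  calc |arg (u / v)| = InnerProductGeometry.angle u v := (angle_eq_abs_arg hu.1 hv.1).symm
    _ ≤ InnerProductGeometry.angle u 1 + InnerProductGeometry.angle 1 v :=
      InnerProductGeometry.angle_le_angle_add_angle u 1 v
    _ = |arg u| + |arg v| := by rw [angle_one_right hu.1, angle_one_left hv.1]
    _ < c + d := add_lt_add hu.2 hv.2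

theorem isOpen_setOf_absArgLt (c : ℝ) : IsOpen {w | AbsArgLt w c} := by
  rw [isOpen_iff_mem_nhds]
  intro w hw
  filter_upwards [isOpen_ne.mem_nhds hw.1,
    (continuousAt_abs_arg hw.1).eventually_lt continuousAt_const hw.2] with z hz harg
    using ⟨hz, harg⟩

theorem eq_zero_or_abs_arg_eq_of_mem_frontier {w : ℂ} {c : ℝ}
    (hw : w ∈ frontier {w | AbsArgLt w c}) : w = 0 ∨ |arg w| = c := by
  rw [(isOpen_setOf_absArgLt c).frontier_eq] at hw
  refine or_iff_not_imp_left.2 fun hne => le_antisymm ?_ (not_lt.1 fun h => hw.2 ⟨hne, h⟩)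
  have hclosure : |arg w| ∈ closure (Iio c) :=
    (continuousAt_abs_arg hne).continuousWithinAt.mem_closure hw.1 fun z hz => hz.2
  exact closure_minimal Iio_subset_Iic_self isClosed_Iic hclosure

/-! ### The lemmas of Jack and Nunokawa -/

theorem mul_deriv_nonneg_of_re_le {G : ℂ → ℂ} {G' z₀ : ℂ} (hG : HasDerivAt G G' z₀)
    (hle : ∀ᶠ z in 𝓝[ball 0 ‖z₀‖] z₀, (G z).re ≤ (G z₀).re) : 0 ≤ z₀ * G' := by
  have hball : ∀ y ∈ ball 0 ‖z₀‖, (G' * y).re ≤ (G' * z₀).re := by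
    intro y hy
    have hsegment : openSegment ℝ z₀ y ⊆ ball 0 ‖z₀‖ := by
      rw [openSegment_symm, ← (isOpen_ball (x := (0 : ℂ))).interior_eq]
      rw [← (isOpen_ball (x := (0 : ℂ))).interior_eq] at hy
      refine (convex_ball 0 _).openSegment_interior_closure_subset_interior hy ?_
      rw [closure_ball 0 (ne_of_gt (pos_of_mem_ball (interior_subset hy)))]
      simp
    have hmax : IsLocalMaxOn (fun z => (G z).re) (ball 0 ‖z₀‖) z₀ := hle
    have hderiv := reCLM.hasFDerivAt.comp z₀ (hG.hasFDerivAt.restrictScalars ℝ)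
    have := hmax.hasFDerivWithinAt_nonpos hderiv.hasFDerivWithinAt
      (sub_mem_posTangentConeAt_of_openSegment_subset hsegment)
    simpa [mul_comm, mul_sub] using this
  set A := z₀ * G' with hA
  -- Compare `z₀` with its rotation `y` for which `G' * y = ‖A‖`.
  suffices hnorm : ‖A‖ ≤ A.re from re_eq_norm.1 (hnorm.antisymm' (re_le_norm A))
  rcases eq_or_ne A 0 with h0 | h0
  · simp [h0]
  have hz₀ : z₀ ≠ 0 := left_ne_zero_of_mul h0
  have hclosedBall : ∀ y ∈ closedBall 0 ‖z₀‖, (G' * y).re ≤ (G' * z₀).re := by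
    rw [← closure_ball 0 (norm_ne_zero_iff.2 hz₀)]
    exact closure_minimal hball
      (isClosed_le (continuous_re.comp (continuous_const_mul G')) continuous_const)
  have hrot : G' * (conj A / ‖A‖ * z₀) = ‖A‖ := by
    have hnorm : (‖A‖ : ℂ) ≠ 0 := by simpa using h0
    calc G' * (conj A / ‖A‖ * z₀) = A * conj A / ‖A‖ := by rw [hA]; ring
      _ = ‖A‖ := by rw [mul_conj']; field_simp
  have := hclosedBall (conj A / ‖A‖ * z₀) (by simp [h0])
  rwa [hrot, ofReal_re, mul_comm] at this

theorem norm_le_mul_div_pow_of_le_analyticOrderAt {h : ℂ → ℂ} {n : ℕ} {R₁ R₂ : ℝ} {z : ℂ}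
    (hd : DifferentiableOn ℂ h (ball 0 R₁)) (hle : ∀ z ∈ ball 0 R₁, ‖h z‖ ≤ R₂)
    (ho : n ≤ analyticOrderAt h 0) (hz : z ∈ ball 0 R₁) : ‖h z‖ ≤ R₂ * (‖z‖ / R₁) ^ n := by
  rcases n with - | m
  · simpa using hle z hz
  have han : AnalyticAt ℂ h 0 :=
    hd.analyticAt (isOpen_ball.mem_nhds (mem_ball_self (pos_of_mem_ball hz)))
  have h0 : h 0 = 0 := by
    refine apply_eq_zero_of_analyticOrderAt_ne_zero fun h0 => ?_
    simp [h0] at ho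
  have hlittle : h =o[𝓝 0] fun z => ‖z‖ ^ m := by
    obtain ⟨g, hg, hhg⟩ := (natCast_le_analyticOrderAt han).1 ho
    have hO : h =O[𝓝 0] fun z => z ^ (m + 1) := by
      refine ((isBigO_refl (fun z : ℂ => z ^ (m + 1)) _).mul
        (hg.continuousAt.isBigO_one ℂ)).congr' ?_ (.of_eq (by simp))
      filter_upwards [hhg] with z hz using by simp [hz]
    simpa only [norm_pow] using (hO.trans_isLittleO (isLittleO_pow_pow m.lt_succ_self)).norm_right
  simpa [h0] using dist_le_mul_div_pow_of_mapsTo_ball_of_isLittleO hd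
    (fun w hw => by simpa [h0] using hle w hw) (by simpa [h0] using hlittle) hz

theorem exists_mul_deriv_eq_mul_of_norm_le {h : ℂ → ℂ} {h' z₀ : ℂ} {n : ℕ}
    (hd : DifferentiableOn ℂ h (ball 0 ‖z₀‖)) (ho : n ≤ analyticOrderAt h 0)
    (hmax : ∀ z ∈ ball 0 ‖z₀‖, ‖h z‖ ≤ ‖h z₀‖) (hderiv : HasDerivAt h h' z₀)
    (hz₀ : z₀ ≠ 0) (hne : h z₀ ≠ 0) :
    ∃ k : ℝ, n ≤ k ∧ z₀ * h' = k * h z₀ := by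
  have hG : HasDerivAt (fun z => h z / h z₀ / (z / z₀) ^ n) (h' / h z₀ - n / z₀) z₀ := by
    refine ((hderiv.div_const (h z₀)).fun_div
      (((hasDerivAt_id' z₀).div_const z₀).fun_pow n) (by simp [hz₀])).congr_deriv ?_
    simp [hz₀, hne, div_eq_mul_inv]
  have hle : ∀ z ∈ ball 0 ‖z₀‖, ‖h z / h z₀ / (z / z₀) ^ n‖ ≤ 1 := by
    intro z hz
    have hschwarz := norm_le_mul_div_pow_of_le_analyticOrderAt hd hmax ho hz
    rw [norm_div, norm_div, norm_pow, norm_div, div_div]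
    exact div_le_one_of_le₀ hschwarz (by positivity)
  -- By Schwarz, `h z / z ^ n` still has its largest modulus over the disk at `z₀`.
  have hnonneg : 0 ≤ z₀ * (h' / h z₀ - n / z₀) := by
    refine mul_deriv_nonneg_of_re_le hG ?_
    filter_upwards [self_mem_nhdsWithin] with z hz
    simpa [hz₀, hne] using (re_le_norm _).trans (hle z hz)
  set c := z₀ * (h' / h z₀ - n / z₀) with hc
  have hreal : (c.re : ℂ) = c := Complex.ext rfl (nonneg_iff.1 hnonneg).2
  refine ⟨c.re + n, by linarith [(nonneg_iff.1 hnonneg).1], ?_⟩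
  rw [ofReal_add, hreal, hc, ofReal_natCast]
  field_simp
  ring

theorem norm_sub_one_div_add_one_le {w : ℂ} (hw : 0 ≤ w.re) : ‖(w - 1) / (w + 1)‖ ≤ 1 := by
  rw [norm_div]
  refine div_le_one_of_le₀ ?_ (norm_nonneg _)
  rw [← sq_le_sq₀ (norm_nonneg _) (norm_nonneg _), ← normSq_eq_norm_sq, ← normSq_eq_norm_sq,
    normSq_sub, normSq_add]
  simp only [map_one, mul_one]
  linarith

theorem analyticOrderAt_div_of_ne_zero {f g : ℂ → ℂ} {z₀ : ℂ} (hf : AnalyticAt ℂ f z₀)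
    (hg : AnalyticAt ℂ g z₀) (hne : g z₀ ≠ 0) :
    analyticOrderAt (f / g) z₀ = analyticOrderAt f z₀ := by
  have hinv : analyticOrderAt g⁻¹ z₀ = 0 := analyticOrderAt_eq_zero.2 (.inr (inv_ne_zero hne))
  rw [div_eq_mul_inv, analyticOrderAt_mul hf (hg.inv hne), hinv, add_zero]

theorem analyticOrderAt_sub_le_comp {ψ p : ℂ → ℂ} {z₀ : ℂ} (hψ : AnalyticAt ℂ ψ (p z₀))
    (hp : AnalyticAt ℂ p z₀) :
    analyticOrderAt (p · - p z₀) z₀ ≤ analyticOrderAt (fun z => ψ (p z) - ψ (p z₀)) z₀ := by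
  have hψ' : AnalyticAt ℂ (ψ · - ψ (p z₀)) (p z₀) := hψ.fun_sub analyticAt_const
  have hpos : 1 ≤ analyticOrderAt (ψ · - ψ (p z₀)) (p z₀) :=
    Order.one_le_iff_ne_zero.2 (hψ'.analyticOrderAt_ne_zero.2 (sub_self _))
  calc analyticOrderAt (p · - p z₀) z₀
      ≤ analyticOrderAt (ψ · - ψ (p z₀)) (p z₀) * analyticOrderAt (p · - p z₀) z₀ :=
        le_mul_of_one_le_left' hpos
    _ = _ := (hψ'.analyticOrderAt_comp hp).symm

theorem exists_mul_deriv_eq_of_re_nonneg {g : ℂ → ℂ} {g' z₀ : ℂ} {n : ℕ} {τ : ℝ}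
    (hd : DifferentiableOn ℂ g (ball 0 ‖z₀‖)) (ho : n ≤ analyticOrderAt (g · - 1) 0)
    (hre : ∀ z ∈ ball 0 ‖z₀‖, 0 ≤ (g z).re) (hderiv : HasDerivAt g g' z₀) (hz₀ : z₀ ≠ 0)
    (hgz₀ : g z₀ = τ * I) :
    ∃ k : ℝ, n ≤ k ∧ z₀ * g' = -(k * (1 + τ ^ 2) / 2 : ℝ) := by
  have hne : ∀ {w : ℂ}, 0 ≤ w.re → w + 1 ≠ 0 := fun {w} hw h => by
    have := congrArg re h
    simp only [add_re, one_re, zero_re] at this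
    linarith
  have hne₀ : (τ * I + 1 : ℂ) ≠ 0 := hne (by simp)
  have hne₁ : (τ * I - 1 : ℂ) ≠ 0 := fun h => by simpa using congrArg re h
  have h0 : (0 : ℂ) ∈ ball 0 ‖z₀‖ := by simpa using hz₀
  have hg0 : AnalyticAt ℂ g 0 := hd.analyticAt (isOpen_ball.mem_nhds h0)
  have ho' : n ≤ analyticOrderAt (fun z => (g z - 1) / (g z + 1)) 0 :=
    ho.trans_eq (analyticOrderAt_div_of_ne_zero (hg0.fun_sub analyticAt_const)
      (hg0.fun_add analyticAt_const) (hne (hre 0 h0))).symm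
  have hd' : DifferentiableOn ℂ (fun z => (g z - 1) / (g z + 1)) (ball 0 ‖z₀‖) :=
    (hd.sub_const 1).fun_div (hd.add_const 1) fun z hz => hne (hre z hz)
  have hderiv' : HasDerivAt (fun z => (g z - 1) / (g z + 1)) (2 * g' / (τ * I + 1) ^ 2) z₀ :=
    ((hderiv.sub_const 1).fun_div (hderiv.add_const 1) (by rwa [hgz₀])).congr_deriv
      (by rw [hgz₀]; ring)
  have hnorm : ‖(g z₀ - 1) / (g z₀ + 1)‖ = 1 := by
    have : conj (τ * I + 1 : ℂ) = -(τ * I - 1) := by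
      rw [map_add, map_mul, conj_ofReal, conj_I, map_one]
      ring
    rw [hgz₀, norm_div, ← norm_conj (τ * I + 1), this, norm_neg, div_self (norm_ne_zero_iff.2 hne₁)]
  obtain ⟨k, hk, hkeq⟩ := exists_mul_deriv_eq_mul_of_norm_le hd' ho'
    (fun z hz => (norm_sub_one_div_add_one_le (hre z hz)).trans_eq hnorm.symm) hderiv' hz₀
    (norm_ne_zero_iff.1 (by rw [hnorm]; exact one_ne_zero))
  refine ⟨k, hk, ?_⟩
  rw [hgz₀] at hkeq
  field_simp at hkeq
  push_cast
  linear_combination hkeq / 2 + k * τ ^ 2 / 2 * I_sq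

theorem mem_slitPlane_of_abs_arg_lt_pi {w : ℂ} (hw : w ≠ 0) (harg : |arg w| < π) :
    w ∈ slitPlane :=
  mem_slitPlane_iff_arg.2 ⟨fun h => by simp [h, abs_of_pos Real.pi_pos] at harg, hw⟩

theorem cpow_inv_re_nonneg_of_abs_arg_le {w : ℂ} {β : ℝ} (hβ : 0 < β)
    (harg : |arg w| ≤ π / 2 * β) : 0 ≤ (w ^ (β⁻¹ : ℂ)).re := by
  have hle : |arg w * β⁻¹| ≤ π / 2 := by
    rwa [abs_mul, abs_of_pos (inv_pos.2 hβ), ← div_eq_mul_inv, div_le_iff₀ hβ]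
  rw [← ofReal_inv, cpow_ofReal_re]
  exact mul_nonneg (Real.rpow_nonneg (norm_nonneg _) _)
    (Real.cos_nonneg_of_mem_Icc (abs_le.1 hle))

theorem exists_cpow_inv_eq_mul_I_of_abs_arg_eq {w : ℂ} {β : ℝ} (hβ : 0 < β) (hw : w ≠ 0)
    (harg : |arg w| = π / 2 * β) :
    ∃ τ : ℝ, w ^ (β⁻¹ : ℂ) = τ * I ∧ |τ| = ‖w‖ ^ β⁻¹ ∧ 0 ≤ τ * w.im := by
  obtain ⟨σ, hσ, hσarg, hσim⟩ :
      ∃ σ : ℝ, |σ| = 1 ∧ arg w * β⁻¹ = σ * (π / 2) ∧ 0 ≤ σ * w.im := by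
    rcases abs_cases (arg w) with ⟨h, h0⟩ | ⟨h, h0⟩
    · exact ⟨1, abs_one, by rw [← h, harg]; field_simp,
        by simpa using arg_nonneg_iff.1 h0⟩
    · exact ⟨-1, by simp, by rw [← neg_eq_iff_eq_neg.2 (harg.symm.trans h)]; field_simp,
        by simpa using (arg_neg_iff.1 h0).le⟩
  have hpos : 0 < ‖w‖ ^ β⁻¹ := Real.rpow_pos_of_pos (norm_pos_iff.2 hw) _
  refine ⟨σ * ‖w‖ ^ β⁻¹, ?_, by rw [abs_mul, hσ, one_mul, abs_of_pos hpos], ?_⟩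
  · rw [← ofReal_inv, cpow_ofReal, hσarg]
    rcases eq_or_eq_neg_of_abs_eq hσ with rfl | rfl <;> simp
  · rw [mul_right_comm]
    exact mul_nonneg hσim hpos.le

theorem exists_mul_deriv_eq_mul_of_abs_arg_eq {p : ℂ → ℂ} {p' z₀ : ℂ} {n : ℕ} {β : ℝ} (hβ0 : 0 < β)
    (hβ2 : β < 2) (hd : DifferentiableOn ℂ p (ball 0 ‖z₀‖)) (hp0 : p 0 = 1)
    (ho : n ≤ analyticOrderAt (p · - 1) 0)
    (hmaps : MapsTo p (ball 0 ‖z₀‖) {w | AbsArgLt w (π / 2 * β)}) (hderiv : HasDerivAt p p' z₀)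
    (hz₀ : z₀ ≠ 0) (hne : p z₀ ≠ 0) (harg : |arg (p z₀)| = π / 2 * β) :
    ∃ ℓ : ℝ, z₀ * p' = ℓ * I * p z₀ ∧ 0 ≤ ℓ * (p z₀).im ∧
      n * β * ((‖p z₀‖ ^ β⁻¹ + (‖p z₀‖ ^ β⁻¹)⁻¹) / 2) ≤ |ℓ| := by
  have hπ : π / 2 * β < π := by linarith [mul_lt_mul_of_pos_left hβ2 Real.pi_div_two_pos]
  obtain ⟨τ, hτ, hτabs, hτim⟩ := exists_cpow_inv_eq_mul_I_of_abs_arg_eq hβ0 hne harg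
  have hτ0 : τ ≠ 0 :=
    abs_pos.1 (hτabs ▸ Real.rpow_pos_of_pos (norm_pos_iff.2 hne) _)
  have hgd : DifferentiableOn ℂ (fun z => p z ^ (β⁻¹ : ℂ)) (ball 0 ‖z₀‖) := fun z hz =>
    (hd z hz).cpow_const (mem_slitPlane_of_abs_arg_lt_pi (hmaps hz).1 ((hmaps hz).2.trans hπ))
  have hgo : n ≤ analyticOrderAt (fun z => p z ^ (β⁻¹ : ℂ) - 1) 0 := by
    have hp : AnalyticAt ℂ p 0 := hd.analyticAt (isOpen_ball.mem_nhds (by simpa using hz₀))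
    have hψ : AnalyticAt ℂ (fun w => w ^ (β⁻¹ : ℂ)) (p 0) :=
      analyticAt_id.cpow analyticAt_const (by simp [hp0])
    have hcomp := analyticOrderAt_sub_le_comp hψ hp
    rw [hp0, one_cpow] at hcomp
    exact ho.trans hcomp
  obtain ⟨k, hk, hkeq⟩ := exists_mul_deriv_eq_of_re_nonneg hgd hgo
    (fun z hz => cpow_inv_re_nonneg_of_abs_arg_le hβ0 (hmaps hz).2.le)
    (hderiv.cpow_const (mem_slitPlane_of_abs_arg_lt_pi hne (harg.trans_lt hπ))) hz₀ hτ
  have hk0 : 0 ≤ k := n.cast_nonneg.trans hk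
  have hβc : (β : ℂ) ≠ 0 := ofReal_ne_zero.2 hβ0.ne'
  have hτc : (τ : ℂ) ≠ 0 := ofReal_ne_zero.2 hτ0
  refine ⟨β * (k * (1 + τ ^ 2) / (2 * τ)), ?_, ?_, ?_⟩
  · rw [cpow_sub _ _ hne, cpow_one, hτ] at hkeq
    push_cast at hkeq ⊢
    field_simp at hkeq ⊢
    linear_combination (-I) * hkeq + z₀ * p' * τ * 2 * I_sq
  · calc 0 ≤ β * (k * (1 + τ ^ 2) / (2 * τ ^ 2)) * (τ * (p z₀).im) := by positivity
      _ = _ := by field_simp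
  · calc n * β * ((‖p z₀‖ ^ β⁻¹ + (‖p z₀‖ ^ β⁻¹)⁻¹) / 2)
        ≤ k * β * ((|τ| + |τ|⁻¹) / 2) := by rw [hτabs]; gcongr
      _ = _ := by
        rw [abs_mul, abs_div, abs_mul, abs_mul, abs_of_pos hβ0, abs_of_nonneg hk0,
          abs_of_pos (by positivity : 0 < 1 + τ ^ 2), abs_two, ← sq_abs τ]
        field_simp
        ring

/-! ### Analytic functions in the unit disk -/

theorem natCast_le_analyticOrderAt_of_hasSum {h : ℂ → ℂ} {a : ℕ → ℂ} {m : ℕ}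
    (hsum : ∀ᶠ z in 𝓝 0, HasSum (fun k => a k * z ^ (m + k)) (h z)) :
    m ≤ analyticOrderAt h 0 := by
  have hG : ∀ᶠ z in 𝓝 0, HasSum (fun k => z ^ k * a k) (∑' k, z ^ k * a k) := by
    filter_upwards [hsum] with z hz
    refine Summable.hasSum ?_
    rcases eq_or_ne z 0 with rfl | hz0
    · exact summable_of_ne_finset_zero (s := {0}) fun k hk => by
        simp [Finset.notMem_singleton.1 hk]
    · refine (hz.summable.mul_left (z ^ m)⁻¹).congr fun k => ?_
      field_simp
      ring
  have hGan : AnalyticAt ℂ (fun z => ∑' k, z ^ k * a k) 0 := by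
    refine ⟨.ofScalars ℂ a, hasFPowerSeriesAt_iff.2 ?_⟩
    simpa using hG
  have heq : (fun z => z ^ m * ∑' k, z ^ k * a k) =ᶠ[𝓝 0] h := by
    filter_upwards [hsum, hG] with z hz hGz
    exact (hGz.mul_left (z ^ m)).unique (by simpa [pow_add, mul_comm, mul_left_comm] using hz)
  have hpow : AnalyticAt ℂ (fun z : ℂ => z ^ m) 0 := by fun_prop
  exact (natCast_le_analyticOrderAt ((hpow.fun_mul hGan).congr heq)).2
    ⟨_, hGan, by simpa [EventuallyEq] using heq.symm⟩

theorem zero_mem_unitDisk : (0 : ℂ) ∈ unitDisk := mem_ball_self one_pos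

theorem isOpen_unitDisk : IsOpen unitDisk := isOpen_ball

theorem ball_norm_subset_unitDisk {z : ℂ} (hz : z ∈ unitDisk) : ball 0 ‖z‖ ⊆ unitDisk :=
  ball_subset_ball (mem_ball_zero_iff.1 hz).le

/-- The class `ℋ[a, n]` of functions analytic in the open unit disk with the expansion
`p(z) = a + aₙ zⁿ + aₙ₊₁ zⁿ⁺¹ + ⋯`, expressed through the order of vanishing of `p - a`
at the origin. -/
def classH (a : ℂ) (n : ℕ) : Set (ℂ → ℂ) :=
  {p | AnalyticOnNhd ℂ p unitDisk ∧ n ≤ analyticOrderAt (p · - a) 0}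

section

variable {a : ℂ} {n : ℕ} {p q f : ℂ → ℂ}

theorem classH.apply_zero (hp : p ∈ classH a n) (hn : n ≠ 0) : p 0 = a := by
  refine sub_eq_zero.1 (apply_eq_zero_of_analyticOrderAt_ne_zero (f := (p · - a)) fun h => ?_)
  simpa [h, hn] using hp.2

theorem classH.div (hp : p ∈ classH a n) (hq : q ∈ classH a n) (hne : ∀ z ∈ unitDisk, q z ≠ 0) :
    p / q ∈ classH 1 n := by
  have hp0 := hp.1 0 zero_mem_unitDisk
  have hq0 := hq.1 0 zero_mem_unitDisk
  refine ⟨hp.1.div hq.1 hne, ?_⟩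
  have heq : ((p / q) · - 1) =ᶠ[𝓝 0] ((p · - a) - (q · - a)) / q := by
    filter_upwards [isOpen_unitDisk.mem_nhds zero_mem_unitDisk] with z hz
    simp [div_sub_one (hne z hz)]
  rw [analyticOrderAt_congr heq, analyticOrderAt_div_of_ne_zero (by fun_prop) hq0
    (hne 0 zero_mem_unitDisk)]
  exact (le_min hp.2 hq.2).trans le_analyticOrderAt_sub

theorem add_one_le_analyticOrderAt_sub_id (hf : f ∈ classA n) :
    n + 1 ≤ analyticOrderAt (f - id) 0 := by
  obtain ⟨-, a, ha⟩ := hf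
  exact_mod_cast natCast_le_analyticOrderAt_of_hasSum (a := fun k => a (n + 1 + k))
    (by filter_upwards [isOpen_unitDisk.mem_nhds zero_mem_unitDisk] using ha)

theorem classA.apply_zero (hf : f ∈ classA n) : f 0 = 0 := by
  have := apply_eq_zero_of_analyticOrderAt_ne_zero (f := f - id) (z₀ := 0) fun h => by
    simpa [h] using add_one_le_analyticOrderAt_sub_id hf
  simpa using this

theorem classA.deriv_mem_classH (hf : f ∈ classA n) : deriv f ∈ classH 1 n := by
  have hf0 := hf.1 0 zero_mem_unitDisk
  have heq : deriv (f - id) =ᶠ[𝓝 0] (deriv f · - 1) := by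
    filter_upwards [hf0.eventually_analyticAt] with z hz
    simpa using deriv_sub hz.differentiableAt differentiableAt_id
  refine ⟨hf.1.deriv, ?_⟩
  rw [← analyticOrderAt_congr heq]
  exact (analyticOrderAt_deriv_ge_iff (hf0.sub analyticAt_id) (by simp [classA.apply_zero hf])).2
    (add_one_le_analyticOrderAt_sub_id hf)

theorem classA.mul_dslope (hf : f ∈ classA n) (z : ℂ) : z * dslope f 0 z = f z := by
  simpa [classA.apply_zero hf] using sub_smul_dslope f 0 z

theorem classA.analyticOnNhd_dslope (hf : f ∈ classA n) :
    AnalyticOnNhd ℂ (dslope f 0) unitDisk :=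
  ((differentiableOn_dslope (isOpen_unitDisk.mem_nhds zero_mem_unitDisk)).2
    hf.1.differentiableOn).analyticOnNhd isOpen_unitDisk

theorem classA.dslope_mem_classH (hf : f ∈ classA n) : dslope f 0 ∈ classH 1 n := by
  have hd := classA.analyticOnNhd_dslope hf
  have heq : f - id = id * (dslope f 0 · - 1) := by
    ext z
    simp [mul_sub, classA.mul_dslope hf]
  have ho := add_one_le_analyticOrderAt_sub_id hf
  rw [heq, analyticOrderAt_mul analyticAt_id
    ((hd 0 zero_mem_unitDisk).fun_sub analyticAt_const), analyticOrderAt_id, add_comm] at ho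
  exact ⟨hd, (ENat.add_le_add_iff_left ENat.one_ne_top).1 ho⟩

theorem classA.deriv_eq (hf : f ∈ classA n) {z : ℂ} (hz : z ∈ unitDisk) :
    deriv f z = dslope f 0 z + z * deriv (dslope f 0) z := by
  have hd := (classA.analyticOnNhd_dslope hf z hz).differentiableAt
  have heq : f = fun z => z * dslope f 0 z := funext fun z => (classA.mul_dslope hf z).symm
  conv_lhs => rw [heq]
  simpa using ((hasDerivAt_id' z).fun_mul hd.hasDerivAt).deriv

end

/-! ### Argument bounds -/

theorem not_absArgLt_of_nonpos {w : ℂ} {c : ℝ} (hw : w ≤ 0) (hc : c ≤ π) : ¬ AbsArgLt w c := by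
  rintro ⟨hne, hlt⟩
  rw [arg_eq_pi_iff_lt_zero.2 (hw.lt_of_ne hne), abs_of_pos Real.pi_pos] at hlt
  exact hlt.not_ge hc

theorem classH.exists_exit_point {p : ℂ → ℂ} {n : ℕ} {β : ℝ} (hp : p ∈ classH 1 n) (hn : n ≠ 0)
    (hβ0 : 0 < β) (hβ1 : β ≤ 1) (hex : ¬ ∀ z ∈ unitDisk, AbsArgLt (p z) (π / 2 * β)) :
    ∃ z₀ ∈ unitDisk,
      (p z₀ = 0 ∧ z₀ * deriv p z₀ ≤ 0) ∨
      (p z₀ ≠ 0 ∧ |arg (p z₀)| = π / 2 * β ∧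
        ∃ ℓ : ℝ, z₀ * deriv p z₀ = ℓ * I * p z₀ ∧ 0 ≤ ℓ * (p z₀).im ∧
          n * β * ((‖p z₀‖ ^ β⁻¹ + (‖p z₀‖ ^ β⁻¹)⁻¹) / 2) ≤ |ℓ|) := by
  have hp0 : p 0 = 1 := classH.apply_zero hp hn
  obtain ⟨z₀, hz₀, hne, hmaps, hfrontier⟩ := exists_mem_frontier_of_not_mapsTo
    (isOpen_setOf_absArgLt (π / 2 * β)) hp.1.continuousOn
    ⟨by simp [hp0], by simpa [hp0] using mul_pos Real.pi_div_two_pos hβ0⟩ hex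
  have hderiv := (hp.1 z₀ hz₀).differentiableAt.hasDerivAt
  refine ⟨z₀, hz₀, ?_⟩
  by_cases hzero : p z₀ = 0
  · refine .inl ⟨hzero, ?_⟩
    suffices 0 ≤ z₀ * -deriv p z₀ by rwa [mul_neg, neg_nonneg] at this
    refine mul_deriv_nonneg_of_re_le hderiv.fun_neg ?_
    filter_upwards [self_mem_nhdsWithin] with z hz
    have hre : 0 ≤ (p z).re := abs_arg_le_pi_div_two_iff.1
      ((hmaps hz).2.le.trans (mul_le_of_le_one_right Real.pi_div_two_pos.le hβ1))
    simpa [hzero] using hre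
  · have harg := (eq_zero_or_abs_arg_eq_of_mem_frontier hfrontier).resolve_left hzero
    exact .inr ⟨hzero, harg, exists_mul_deriv_eq_mul_of_abs_arg_eq hβ0 (by linarith)
      (hp.1.differentiableOn.mono (ball_norm_subset_unitDisk hz₀)) hp0 hp.2 hmaps
      hderiv hne hzero harg⟩

theorem one_le_add_inv_div_two {a : ℝ} (ha : 0 < a) : 1 ≤ (a + a⁻¹) / 2 := by
  have : a + a⁻¹ - 2 = (a - 1) ^ 2 / a := by field_simp; ring
  have : 0 ≤ (a - 1) ^ 2 / a := by positivity
  linarith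

theorem absArgLt_of_absArgLt_add_mul_deriv {p : ℂ → ℂ} {n : ℕ} {β : ℝ} (hp : p ∈ classH 1 n)
    (hn : n ≠ 0) (hβ0 : 0 < β) (hβ1 : β ≤ 1)
    (harg : ∀ z ∈ unitDisk, AbsArgLt (p z + z * deriv p z) (π / 2 * β + Real.arctan (n * β))) :
    ∀ z ∈ unitDisk, AbsArgLt (p z) (π / 2 * β) := by
  have hβπ : π / 2 * β ≤ π / 2 := mul_le_of_le_one_right Real.pi_div_two_pos.le hβ1
  by_contra hex
  obtain ⟨z₀, hz₀, ⟨hzero, hnonpos⟩ | ⟨hne, habs, ℓ, hℓ, hℓim, hle⟩⟩ :=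
    classH.exists_exit_point hp hn hβ0 hβ1 hex
  · refine not_absArgLt_of_nonpos (by simpa [hzero] using hnonpos) ?_ (harg z₀ hz₀)
    linarith [Real.arctan_lt_pi_div_two (n * β)]
  · have hfactor : p z₀ + z₀ * deriv p z₀ = p z₀ * (1 + ℓ * I) := by rw [hℓ]; ring
    have hℓβ : n * β ≤ |ℓ| := (le_mul_of_one_le_right (by positivity)
      (one_le_add_inv_div_two (Real.rpow_pos_of_pos (norm_pos_iff.2 hne) _))).trans hle
    obtain ⟨hne', hlt⟩ := harg z₀ hz₀
    rw [hfactor] at hne' hlt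
    rw [abs_arg_mul hne (right_ne_zero_of_mul hne') (by simpa [mul_comm] using hℓim),
      habs, abs_arg_one_add_mul_I] at hlt
    · linarith [Real.arctan_mono hℓβ]
    · rw [habs, abs_arg_one_add_mul_I]
      linarith [Real.arctan_lt_pi_div_two |ℓ|]

theorem inv_one_sub_mul_rpow_le_one_add {s y : ℝ} (hs0 : 0 < s) (hs1 : s < 1) (hy : 0 < y) :
    (1 - s)⁻¹ * ((1 - s) / s) ^ s * y ^ s ≤ 1 + y := by
  have hs : 0 < 1 - s := sub_pos.2 hs1
  have amgm := Real.geom_mean_le_arith_mean2_weighted hs0.le hs.le (div_pos hy hs0).le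
    (inv_pos.2 hs).le (by ring)
  have hpow : ((1 - s)⁻¹) ^ (1 - s) = (1 - s)⁻¹ * (1 - s) ^ s := by
    rw [Real.rpow_sub (inv_pos.2 hs), Real.rpow_one, Real.inv_rpow hs.le, div_inv_eq_mul]
  calc (1 - s)⁻¹ * ((1 - s) / s) ^ s * y ^ s = (y / s) ^ s * ((1 - s)⁻¹) ^ (1 - s) := by
        rw [hpow, Real.div_rpow hs.le hs0.le, Real.div_rpow hy.le hs0.le]
        ring
    _ ≤ s * (y / s) + (1 - s) * (1 - s)⁻¹ := amgm
    _ = 1 + y := by field_simp; ring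

theorem inv_one_sub_mul_rpow_le_div_rpow {μ a : ℝ} (hμ0 : -1 < μ) (hμ1 : μ ≤ 1) (ha : 0 < a) :
    (1 - μ)⁻¹ * ((1 - μ) / (1 + μ)) ^ ((1 + μ) / 2) ≤ (a + a⁻¹) / 2 / a ^ μ := by
  rcases hμ1.eq_or_lt with rfl | hlt
  · simp only [sub_self, inv_zero, zero_mul]
    positivity
  have h := inv_one_sub_mul_rpow_le_one_add (s := (1 + μ) / 2) (y := a ^ 2) (by linarith)
    (by linarith) (by positivity)
  have hy : (a ^ 2) ^ ((1 + μ) / 2) = a * a ^ μ := by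
    rw [← Real.rpow_natCast_mul ha.le, Nat.cast_two, mul_div_cancel₀ _ two_ne_zero,
      Real.rpow_one_add' ha.le (by linarith)]
  have hsub : 1 - (1 + μ) / 2 = (1 - μ) / 2 := by ring
  rw [hy, hsub, div_div_div_cancel_right₀ two_ne_zero, inv_div] at h
  calc (1 - μ)⁻¹ * ((1 - μ) / (1 + μ)) ^ ((1 + μ) / 2)
      = 2 / (1 - μ) * ((1 - μ) / (1 + μ)) ^ ((1 + μ) / 2) * (a * a ^ μ) /
          (2 * a * a ^ μ) := by field_simp
    _ ≤ (1 + a ^ 2) / (2 * a * a ^ μ) := by gcongr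
    _ = (a + a⁻¹) / 2 / a ^ μ := by field_simp; ring

theorem phi_le {n : ℕ} {μ t : ℝ} (hμ0 : 0 < μ) (hμ1 : μ ≤ 1)
    (ht : n * μ * ((1 - μ)⁻¹ * ((1 - μ) / (1 + μ)) ^ ((1 + μ) / 2)) ≤ t) :
    phi n μ ≤ π / 2 * (μ + 1) -
      Real.arctan (Real.cos (π / 2 * μ) / (Real.sin (π / 2 * μ) + t)) := by
  have hcos : 0 ≤ Real.cos (π / 2 * μ) :=
    Real.cos_nonneg_of_mem_Icc ⟨by nlinarith [Real.pi_pos], by nlinarith [Real.pi_pos]⟩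
  have hsin : 0 < Real.sin (π / 2 * μ) :=
    Real.sin_pos_of_pos_of_lt_pi (by positivity) (by nlinarith [Real.pi_pos])
  have : 0 ≤ 1 - μ := by linarith
  rw [phi, show μ * π / 2 = π / 2 * μ by ring, div_eq_mul_inv _ (1 - μ), mul_assoc (n * μ : ℝ)]
  gcongr

theorem phi_le_pi {n : ℕ} {μ : ℝ} (hμ0 : 0 ≤ μ) (hμ1 : μ ≤ 1) : phi n μ ≤ π := by
  have hcos : 0 ≤ Real.cos (μ * π / 2) :=
    Real.cos_nonneg_of_mem_Icc ⟨by nlinarith [Real.pi_pos], by nlinarith [Real.pi_pos]⟩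
  have hsin : 0 ≤ Real.sin (μ * π / 2) :=
    Real.sin_nonneg_of_nonneg_of_le_pi (by positivity) (by nlinarith [Real.pi_pos])
  have : 0 ≤ 1 - μ := by linarith
  calc phi n μ ≤ π / 2 * (μ + 1) := sub_le_self _ (Real.arctan_nonneg.2 (by positivity))
    _ ≤ π := by nlinarith [Real.pi_pos]

theorem abs_arg_add_mul_I {w : ℂ} {ℓ : ℝ} (hw : w ≠ 0) (hℓ : ℓ ≠ 0) (him : 0 ≤ ℓ * w.im) :
    |arg (w + ℓ * I)| =
      π / 2 - Real.arctan (Real.cos |arg w| / (Real.sin |arg w| + |ℓ| / ‖w‖)) := by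
  have : 0 < ‖w‖ := norm_pos_iff.2 hw
  have hre : ‖w‖ * Real.cos |arg w| = w.re := by rw [Real.cos_abs, norm_mul_cos_arg]
  have him' : ‖w‖ * Real.sin |arg w| = |w.im| := by
    rw [← Real.abs_sin_eq_sin_abs_of_abs_le_pi (abs_arg_le_pi w), ← norm_mul_sin_arg w, abs_mul,
      abs_norm]
  have habs : |w.im + ℓ| = |w.im| + |ℓ| := by
    rw [abs_add_eq_add_abs_iff]
    rcases mul_nonneg_iff.1 him with h | h <;> simp [h]
  have him₀ : (w + ℓ * I).im ≠ 0 := by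
    suffices 0 < |w.im + ℓ| by simpa using this
    rw [habs]
    positivity
  rw [abs_arg_eq_pi_div_two_sub_arctan him₀]
  congr 2
  simp only [add_re, add_im, mul_re, mul_im, ofReal_re, ofReal_im, I_re, I_im, mul_zero, mul_one,
    sub_zero, add_zero]
  rw [habs, ← hre, ← him']
  field_simp

theorem absArgLt_of_absArgLt_sq_add_mul_deriv {P : ℂ → ℂ} {n : ℕ} {μ : ℝ} (hP : P ∈ classH 1 n)
    (hn : n ≠ 0) (hμ0 : 0 < μ) (hμ1 : μ ≤ 1)
    (harg : ∀ z ∈ unitDisk, AbsArgLt (P z ^ 2 + z * deriv P z) (phi n μ)) :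
    ∀ z ∈ unitDisk, AbsArgLt (P z) (π / 2 * μ) := by
  by_contra hex
  obtain ⟨z₀, hz₀, ⟨hzero, hnonpos⟩ | ⟨hw, habs, ℓ, hℓ, hℓim, hle⟩⟩ :=
    classH.exists_exit_point hP hn hμ0 hμ1 hex
  · exact not_absArgLt_of_nonpos (by simpa [hzero] using hnonpos) (phi_le_pi hμ0.le hμ1)
      (harg z₀ hz₀)
  set w := P z₀
  have hnorm : 0 < ‖w‖ := norm_pos_iff.2 hw
  have hapos : 0 < ‖w‖ ^ μ⁻¹ := Real.rpow_pos_of_pos hnorm _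
  have hℓ0 : ℓ ≠ 0 := abs_pos.1 (lt_of_lt_of_le (by positivity) hle)
  have hphi := phi_le (n := n) (t := |ℓ| / ‖w‖) hμ0 hμ1 <| calc
    n * μ * ((1 - μ)⁻¹ * ((1 - μ) / (1 + μ)) ^ ((1 + μ) / 2))
      ≤ n * μ * ((‖w‖ ^ μ⁻¹ + (‖w‖ ^ μ⁻¹)⁻¹) / 2 / (‖w‖ ^ μ⁻¹) ^ μ) := by
        gcongr
        exact inv_one_sub_mul_rpow_le_div_rpow (by linarith) hμ1 hapos
    _ = n * μ * ((‖w‖ ^ μ⁻¹ + (‖w‖ ^ μ⁻¹)⁻¹) / 2) / ‖w‖ := by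
        rw [Real.rpow_inv_rpow hnorm.le hμ0.ne', mul_div_assoc]
    _ ≤ |ℓ| / ‖w‖ := by gcongr
  have hre : 0 ≤ w.re := abs_arg_le_pi_div_two_iff.1
    (habs.trans_le (mul_le_of_le_one_right Real.pi_div_two_pos.le hμ1))
  have him : 0 ≤ w.im * (w + ℓ * I).im := by
    calc 0 ≤ w.im ^ 2 + ℓ * w.im := add_nonneg (sq_nonneg _) hℓim
      _ = w.im * (w + ℓ * I).im := by rw [add_im, im_ofReal_mul, I_im]; ring
  have hle_pi : |arg w| + |arg (w + ℓ * I)| ≤ π := by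
    linarith [abs_arg_le_pi_div_two_iff.2 hre,
      abs_arg_le_pi_div_two_iff.2 (show 0 ≤ (w + ℓ * I).re by simpa using hre)]
  have hfactor : w ^ 2 + z₀ * deriv P z₀ = w * (w + ℓ * I) := by rw [hℓ]; ring
  obtain ⟨hne', hlt⟩ := harg z₀ hz₀
  rw [hfactor] at hne' hlt
  rw [abs_arg_mul hw (right_ne_zero_of_mul hne') him hle_pi, abs_arg_add_mul_I hw hℓ0 hℓim,
    habs] at hlt
  linarith

theorem sq_div_add_mul_deriv_div {p q : ℂ → ℂ} {z : ℂ} (hp : DifferentiableAt ℂ p z)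
    (hq : DifferentiableAt ℂ q z) (hne : q z ≠ 0) (heq : p z = q z + z * deriv q z) :
    (p / q) z ^ 2 + z * deriv (p / q) z = (p z + z * deriv p z) / q z := by
  rw [deriv_div hp hq hne, Pi.div_apply]
  field_simp
  linear_combination p z * heq

theorem mem_classSTS_of_absArgLt {f : ℂ → ℂ} {n : ℕ} {μ c d : ℝ} (hf : f ∈ classA n) (hn : n ≠ 0)
    (hμ0 : 0 < μ) (hμ1 : μ ≤ 1)
    (harg : ∀ z ∈ unitDisk, AbsArgLt (deriv f z + z * deriv (deriv f) z) c)
    (hslope : ∀ z ∈ unitDisk, AbsArgLt (dslope f 0 z) d) (hcd : c + d ≤ phi n μ) :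
    f ∈ classSTS n μ := by
  set q := dslope f 0
  have hf' : deriv f ∈ classH 1 n := classA.deriv_mem_classH hf
  have hq : q ∈ classH 1 n := classA.dslope_mem_classH hf
  have hquotient : ∀ z ∈ unitDisk, AbsArgLt ((deriv f / q) z) (π / 2 * μ) := by
    refine absArgLt_of_absArgLt_sq_add_mul_deriv (classH.div hf' hq fun z hz => (hslope z hz).1)
      hn hμ0 hμ1 fun z hz => ?_
    rw [sq_div_add_mul_deriv_div (hf'.1 z hz).differentiableAt (hq.1 z hz).differentiableAt
      (hslope z hz).1 (classA.deriv_eq hf hz)]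
    exact ((harg z hz).div (hslope z hz)).mono hcd
  refine ⟨hf, hμ0, hμ1, fun z hz hz0 => ?_⟩
  rw [← classA.mul_dslope hf z, mul_div_mul_left _ _ hz0]
  exact ⟨mul_ne_zero hz0 (hslope z hz).1, hquotient z hz⟩

theorem pi_div_two_mul_eq_add {α β t : ℝ} (h : α = β + 2 / π * t) :
    π / 2 * α = π / 2 * β + t := by
  rw [h]
  field_simp

theorem theorem1 (n : ℕ) (hn : 1 ≤ n) (f : ℂ → ℂ) (hf : f ∈ classA n)
    (α β γ μ : ℝ) (hα : 0 < α) (hγ : 0 < γ) (hμ0 : 0 < μ) (hμ1 : μ ≤ 1)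
    (hαβ : α = β + 2 / Real.pi * Real.arctan (n * β))
    (hβγ : β = γ + 2 / Real.pi * Real.arctan (n * γ))
    (hφ : Real.pi / 2 * (α + γ) ≤ phi n μ)
    (harg : ∀ z ∈ unitDisk, AbsArgLt (deriv f z + z * deriv (deriv f) z) (Real.pi / 2 * α)) :
    f ∈ classSTS n μ := by
  have hn0 : n ≠ 0 := Nat.one_le_iff_ne_zero.1 hn
  have hα' : π / 2 * α = π / 2 * β + Real.arctan (n * β) := pi_div_two_mul_eq_add hαβ
  have hβ' : π / 2 * β = π / 2 * γ + Real.arctan (n * γ) := pi_div_two_mul_eq_add hβγ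
  have hγβ : γ ≤ β := by
    refine le_of_mul_le_mul_left ?_ Real.pi_div_two_pos
    exact hβ' ▸ le_add_of_nonneg_right (Real.arctan_nonneg.2 (by positivity))
  have hβ1 : β ≤ 1 := by
    have harctan : Real.arctan (n * γ) ≤ Real.arctan (n * β) := Real.arctan_mono (by gcongr)
    refine le_of_mul_le_mul_left ?_ Real.pi_pos
    linarith [phi_le_pi (n := n) hμ0.le hμ1]
  have hderiv : ∀ z ∈ unitDisk, AbsArgLt (deriv f z) (π / 2 * β) :=
    absArgLt_of_absArgLt_add_mul_deriv (classA.deriv_mem_classH hf) hn0 (hγ.trans_le hγβ) hβ1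
      fun z hz => hα' ▸ harg z hz
  have hslope : ∀ z ∈ unitDisk, AbsArgLt (dslope f 0 z) (π / 2 * γ) :=
    absArgLt_of_absArgLt_add_mul_deriv (classA.dslope_mem_classH hf) hn0 hγ (hγβ.trans hβ1)
      fun z hz => hβ' ▸ classA.deriv_eq hf hz ▸ hderiv z hz
  exact mem_classSTS_of_absArgLt hf hn0 hμ0 hμ1 harg hslope (by rwa [← mul_add])
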